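/- **Theorem (Growth properties in the primal).** Let $\mathbb{S}^n$ be the space of real symmetric $n\times n$ matrices with the inner product $\langle X,Y\rangle=\mathrm{tr}(X^{\mathsf T}Y)$ and the Frobenius norm, and let $\mathbb{S}^n_+\subseteq\mathbb{S}^n$ be the cone of positive semidefinite matrices. Let $C,A_1,\dots,A_m\in\mathbb{S}^n$ and $b\in\mathbb{R}^m$, put $\mathcal{A}(X)=(\langle A_1,X\rangle,\dots,\langle A_m,X\rangle)$ and $\mathcal{A}^*(y)=\sum_{i=1}^m y_iA_i$, and assume that $\mathcal{A}:\mathbb{S}^n\to\mathbb{R}^m$ is surjective. Let $$p^\star=\inf\{\langle C,X\rangle : \mathcal{A}(X)=b,\ X\in\mathbb{S}^n_+\},\qquad d^\star=\sup\{\langle b,y\rangle : \mathcal{A}^*(y)+Z=C,\ Z\in\mathbb{S}^n_+\},$$ and let $\Omega_{\mathrm P}\subseteq\mathbb{S}^n$ and $\Omega_{\mathrm D}\subseteq\mathbb{R}^m\times\mathbb{S}^n$ be the sets of optimal solutions $X$ and $(y,Z)$ of these two problems. Assume strong duality, $p^\star=d^\star$, and let $(\bar X^\star,\bar y^\star,\bar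 Z^\star)$ satisfy dual strict complementarity, that is, $\bar X^\star\in\Omega_{\mathrm P}$, $(\bar y^\star,\bar Z^\star)\in\Omega_{\mathrm D}$ and $$\bar X^\star\in\mathrm{relint}\big(\mathcal{N}_{(\mathbb{S}^n_+)^\circ}(-\bar Z^\star)\big),$$ where $(\mathbb{S}^n_+)^\circ$ is the polar cone of $\mathbb{S}^n_+$, $\mathcal{N}_K(z)$ is the normal cone of $K$ at $z$, and $\mathrm{relint}$ is the relative interior. Let $f_{\mathrm P}(X)=\langle C,X\rangle+g(X)\in(-\infty,+\infty]$, where $g$ is either the indicator function $\delta_{\mathbb{S}^n_+}$ ($0$ on $\mathbb{S}^n_+$, $+\infty$ elsewhere) or the exact penalty function $g(X)=\rho\max\{0,\lambda_{\max}(-X)\}$ with $\rho>\mathrm{tr}(\bar Z^\star)$. 1. For every compact set $\mathcal{U}\subseteq\mathbb{S}^n$ that contains a point of $\Omega_{\mathrm P}$ there are constants $\kappa,\gamma,\alpha>0$ such that for all $X\in\mathcal{U}$ $$f_{\mathrm P}(X)-p^\star+\gamma\|\mathcal{A}(X)-b\|\ \ge\ \kappa\cdot\mathrm{dist}^2(X,\Omega_{\mathrm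 P}),$$ $$\langle C,X\rangle-p^\star+\gamma\|\mathcal{A}(X)-b\|+\alpha\cdot\mathrm{dist}(X,\mathbb{S}^n_+)\ \ge\ \kappa\cdot\mathrm{dist}^2(X,\Omega_{\mathrm P}).$$ 2. If $\Omega_{\mathrm P}$ is compact, then for every $\beta\in\mathbb{R}$ there are constants $\kappa,\gamma,\alpha>0$ such that both bounds hold for all $X$ in the sublevel set $\{X\in\mathbb{S}^n : f_{\mathrm P}(X)\le\beta,\ \mathcal{A}(X)=b\}$. -/

import Mathlib

noncomputable section

/-! ## The Euclidean space of real symmetric matrices -/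

/-- The linear subspace of symmetric matrices inside all real `n × n` matrices. -/
def symmSubmodule (n : ℕ) : Submodule ℝ (Matrix (Fin n) (Fin n) ℝ) where
  carrier := {X | X.IsSymm}
  add_mem' hX hY := Matrix.IsSymm.add hX hY
  zero_mem' := Matrix.isSymm_zero
  smul_mem' c _ hX := Matrix.IsSymm.smul hX c

/-- The space `𝕊ⁿ` of real symmetric `n × n` matrices. It is a type of its own so that its norm and
topology are those of the trace inner product below. -/
def SymMat (n : ℕ) : Type := symmSubmodule n

namespace SymMat

variable {n : ℕ}

instance : AddCommGroup (SymMat n) := inferInstanceAs (AddCommGroup (symmSubmodule n))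

instance : Module ℝ (SymMat n) := inferInstanceAs (Module ℝ (symmSubmodule n))

/-- The inclusion of `𝕊ⁿ` into all matrices. -/
def toMatrix : SymMat n →ₗ[ℝ] Matrix (Fin n) (Fin n) ℝ := (symmSubmodule n).subtype

theorem toMatrix_injective : Function.Injective (toMatrix (n := n)) :=
  Subtype.val_injective

theorem isSymm (X : SymMat n) : X.toMatrix.IsSymm := X.2

theorem isHermitian (X : SymMat n) : X.toMatrix.IsHermitian := by
  have h : X.toMatrix.transpose = X.toMatrix := X.isSymm
  rw [Matrix.IsHermitian, Matrix.conjTranspose_eq_transpose_of_trivial, h]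

/-- The trace inner product `⟨X, Y⟩ = tr (Xᵀ Y)`. -/
def traceInner (X Y : SymMat n) : ℝ := (X.toMatrix.transpose * Y.toMatrix).trace

theorem traceInner_eq_sum (X Y : SymMat n) :
    traceInner X Y = ∑ j, ∑ i, X.toMatrix i j * Y.toMatrix i j := by
  simp [traceInner, Matrix.trace, Matrix.mul_apply]

abbrev innerCore : InnerProductSpace.Core ℝ (SymMat n) where
  inner := traceInner
  conj_inner_symm X Y := by
    simp [traceInner_eq_sum, mul_comm]
  re_inner_nonneg X := by
    simp only [traceInner_eq_sum, RCLike.re_to_real]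
    exact Finset.sum_nonneg fun j _ => Finset.sum_nonneg fun i _ => mul_self_nonneg _
  add_left X Y W := by
    simp [traceInner_eq_sum, add_mul, Finset.sum_add_distrib]
  smul_left X Y r := by
    simp [traceInner_eq_sum, mul_assoc, Finset.mul_sum]
  definite X h := by
    have h' : ∑ j, ∑ i, X.toMatrix i j * X.toMatrix i j = 0 := by
      rw [← traceInner_eq_sum]; exact h
    apply toMatrix_injective
    ext i j
    rw [Finset.sum_eq_zero_iff_of_nonneg
      fun j _ => Finset.sum_nonneg fun i _ => mul_self_nonneg _] at h'
    have h2 := h' j (Finset.mem_univ j)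
    rw [Finset.sum_eq_zero_iff_of_nonneg fun i _ => mul_self_nonneg _] at h2
    simpa using h2 i (Finset.mem_univ i)

/-- The norm of `𝕊ⁿ` is the Frobenius norm, the norm of the trace inner product. -/
instance : NormedAddCommGroup (SymMat n) :=
  @InnerProductSpace.Core.toNormedAddCommGroup ℝ (SymMat n) _ _ _ innerCore

instance : InnerProductSpace ℝ (SymMat n) := InnerProductSpace.ofCore innerCore.toCore

theorem inner_def (X Y : SymMat n) :
    inner ℝ X Y = (X.toMatrix.transpose * Y.toMatrix).trace := rfl

/-- The cone `𝕊ⁿ₊` of positive semidefinite matrices. -/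
def psdCone (n : ℕ) : Set (SymMat n) := {X | X.toMatrix.PosSemidef}

/-- The largest eigenvalue of a symmetric matrix. -/
def lambdaMax (X : SymMat n) : ℝ := ⨆ i, X.isHermitian.eigenvalues i

/-- The indicator function `δ` of `𝕊ⁿ₊`: `0` on the cone and `+∞` off it. -/
def psdIndicator (X : SymMat n) : EReal :=
  open Classical in if X ∈ psdCone n then 0 else ⊤

/-- The penalty function `X ↦ ρ max {0, λ_max (-X)}`. -/
def penalty (ρ : ℝ) (X : SymMat n) : EReal := ((ρ * max 0 (lambdaMax (-X)) : ℝ) : EReal)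

end SymMat

/-! ## Convex analysis -/

/-- The polar cone `K° = {y | ⟨y, x⟩ ≤ 0 for all x ∈ K}`. -/
def polarCone {E : Type*} [NormedAddCommGroup E] [InnerProductSpace ℝ E] (K : Set E) : Set E :=
  {y | ∀ x ∈ K, inner ℝ y x ≤ 0}

/-- The normal cone of `K` at `z`: `{v | ⟨v, y - z⟩ ≤ 0 for all y ∈ K}` if `z ∈ K`, and empty
otherwise. -/
def normalCone {E : Type*} [NormedAddCommGroup E] [InnerProductSpace ℝ E] (K : Set E) (z : E) :
    Set E :=
  {v | z ∈ K ∧ ∀ y ∈ K, inner ℝ v (y - z) ≤ 0}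

/-! ## Semidefinite programs -/

/-- The data of a primal-dual pair of semidefinite programs. -/
structure SDP (n m : ℕ) where
  /-- the cost matrix -/
  C : SymMat n
  /-- the constraint matrices `A₁, …, A_m` -/
  A : Fin m → SymMat n
  /-- the right-hand side -/
  b : EuclideanSpace ℝ (Fin m)

namespace SDP

open SymMat

variable {n m : ℕ} (S : SDP n m)

/-- The linear map `𝒜 X = (⟨A₁, X⟩, …, ⟨A_m, X⟩)`. -/
def map (X : SymMat n) : EuclideanSpace ℝ (Fin m) :=
  WithLp.toLp 2 fun i => inner ℝ (S.A i) X

/-- The adjoint map `𝒜* y = ∑ yᵢ Aᵢ`. -/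
def adj (y : EuclideanSpace ℝ (Fin m)) : SymMat n := ∑ i, y i • S.A i

/-- The feasible set of the primal program. -/
def primalFeasible : Set (SymMat n) := {X | S.map X = S.b ∧ X ∈ psdCone n}

/-- The feasible set of the dual program. -/
def dualFeasible : Set (EuclideanSpace ℝ (Fin m) × SymMat n) :=
  {w | S.adj w.1 + w.2 = S.C ∧ w.2 ∈ psdCone n}

/-- The primal optimal value `p⋆`, in the extended reals. -/
def primalValue : EReal := ⨅ X ∈ S.primalFeasible, ((inner ℝ S.C X : ℝ) : EReal)

/-- The dual optimal value `d⋆`, in the extended reals. -/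
def dualValue : EReal := ⨆ w ∈ S.dualFeasible, ((inner ℝ S.b w.1 : ℝ) : EReal)

/-- The set `Ω_P` of primal optimal solutions. -/
def primalSolutions : Set (SymMat n) :=
  {X | X ∈ S.primalFeasible ∧ ((inner ℝ S.C X : ℝ) : EReal) = S.primalValue}

/-- The set `Ω_D` of dual optimal solutions. -/
def dualSolutions : Set (EuclideanSpace ℝ (Fin m) × SymMat n) :=
  {w | w ∈ S.dualFeasible ∧ ((inner ℝ S.b w.1 : ℝ) : EReal) = S.dualValue}

/-- Strong duality: `p⋆ = d⋆`. -/
def StrongDuality : Prop := S.primalValue = S.dualValue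

/-- Dual strict complementarity of a triple `(X, y, Z)`: it is a pair of optimal solutions, and `X`
lies in the relative interior of the normal cone of `(𝕊ⁿ₊)°` at `-Z`. -/
def DualStrictComplementary (X : SymMat n) (y : EuclideanSpace ℝ (Fin m)) (Z : SymMat n) : Prop :=
  X ∈ S.primalSolutions ∧ (y, Z) ∈ S.dualSolutions ∧
    X ∈ intrinsicInterior ℝ (normalCone (polarCone (psdCone n)) (-Z))

/-- The reformulated cost `f_P(X) = ⟨C, X⟩ + g(X)`. -/
def cost (g : SymMat n → EReal) (X : SymMat n) : EReal := ((inner ℝ S.C X : ℝ) : EReal) + g X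

/-- The sublevel set `{X | f_P(X) ≤ β, 𝒜 X = b}`. -/
def sublevel (g : SymMat n → EReal) (β : ℝ) : Set (SymMat n) :=
  {X | S.cost g X ≤ (β : EReal) ∧ S.map X = S.b}

/-- The two growth bounds, with constants `κ`, `γ`, `α`, at every point of the set `U`. -/
def GrowthBounds (g : SymMat n → EReal) (κ γ α : ℝ) (U : Set (SymMat n)) : Prop :=
  (∀ X ∈ U,
    S.cost g X - S.primalValue + ((γ * ‖S.map X - S.b‖ : ℝ) : EReal) ≥
      ((κ * Metric.infDist X S.primalSolutions ^ 2 : ℝ) : EReal)) ∧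
  (∀ X ∈ U,
    ((inner ℝ S.C X : ℝ) : EReal) - S.primalValue + ((γ * ‖S.map X - S.b‖ : ℝ) : EReal)
        + ((α * Metric.infDist X (psdCone n) : ℝ) : EReal) ≥
      ((κ * Metric.infDist X S.primalSolutions ^ 2 : ℝ) : EReal))

end SDP

end

/-!
Let `Z` be the dual slack. For every `X` the gap splits as
`⟨C, X⟩ - p⋆ = ⟨Z, X⟩ + ⟨y, 𝒜 X - b⟩`, so a multiple of `‖𝒜 X - b‖` absorbs the last term and the
growth of `⟨Z, ·⟩` remains to be bounded from below. The optimal solutions are the points of the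
affine subspace `{𝒜 X = b}` in the face `F = {X ⪰ 0 : ⟨Z, X⟩ = 0}`, and `F` is the normal cone of
the polar cone at `-Z`. Two facts give the quadratic growth.

* On bounded parts of the cone, `dist² (X, F) ≤ c ⟨Z, X⟩`: compress `X` to the kernel of `Z`
  (`SymMat.exists_mem_exposedFace_sq_norm_sub_le`).
* Strict complementarity puts a relative interior point of `F` on the affine subspace, so that the
  distance from a point of a bounded part of `F` to the solution set is at most a multiple of the
  residual `‖𝒜 X - b‖` (`exists_mem_eq_norm_sub_le_of_mem_intrinsicInterior`).

A point `X` off the cone is compared with some `Y` in the cone, at the price of the first power of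
`‖X - Y‖` (`SymMat.exists_mul_sq_infDist_le`). For the bound with `dist (X, 𝕊ⁿ₊)`, `Y` is the
projection of `X`; for the penalty it is the shift `X + s I` with `s = max 0 (λ_max (-X))`, which
`ρ > tr Z` pays for. If the solution set is compact, growth near it and the convexity of the cone
bound the sublevel sets (`SymMat.exists_norm_le_of_isBounded`), which reduces the second part to the
first.
-/

noncomputable section

/-! ### The cone of positive semidefinite matrices and its exposed faces -/

namespace SymMat

variable {n : ℕ}

instance : FiniteDimensional ℝ (SymMat n) :=
  inferInstanceAs (FiniteDimensional ℝ (symmSubmodule n))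

/-- A symmetric matrix as an element of `𝕊ⁿ`. -/
def ofMatrix (M : Matrix (Fin n) (Fin n) ℝ) (h : M.IsSymm) : SymMat n := ⟨M, h⟩

@[simp]
theorem toMatrix_ofMatrix (M : Matrix (Fin n) (Fin n) ℝ) (h : M.IsSymm) :
    (ofMatrix M h).toMatrix = M := rfl

instance : One (SymMat n) := ⟨ofMatrix 1 Matrix.isSymm_one⟩

@[simp]
theorem toMatrix_one : (1 : SymMat n).toMatrix = 1 := rfl

theorem inner_eq_trace_mul (X Y : SymMat n) :
    inner ℝ X Y = (X.toMatrix * Y.toMatrix).trace := by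
  rw [inner_def, X.isSymm]

theorem inner_one_right (X : SymMat n) : inner ℝ X 1 = X.toMatrix.trace := by
  rw [inner_eq_trace_mul, toMatrix_one, mul_one]

open scoped Matrix.Norms.Frobenius in
theorem frobenius_norm_sq {p q : ℕ} (M : Matrix (Fin p) (Fin q) ℝ) :
    ‖M‖ ^ 2 = (M.transpose * M).trace := by
  have h0 : 0 ≤ ∑ i, ∑ j, ‖M i j‖ ^ (2 : ℝ) :=
    Finset.sum_nonneg fun i _ => Finset.sum_nonneg fun j _ => by positivity
  rw [Matrix.frobenius_norm_def, ← Real.sqrt_eq_rpow, Real.sq_sqrt h0, Finset.sum_comm]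
  simp [Matrix.trace, Matrix.mul_apply, pow_two]

open scoped Matrix.Norms.Frobenius in
theorem norm_toMatrix (X : SymMat n) : ‖X.toMatrix‖ = ‖X‖ := by
  have h : ‖X.toMatrix‖ ^ 2 = ‖X‖ ^ 2 := by
    rw [frobenius_norm_sq, ← real_inner_self_eq_norm_sq, inner_def]
  exact (pow_left_inj₀ (norm_nonneg _) (norm_nonneg _) two_ne_zero).1 h

/-- Every symmetric matrix is diagonalized by an orthogonal change of basis. -/
theorem exists_spectral (X : SymMat n) : ∃ U : Matrix (Fin n) (Fin n) ℝ,
    U.transpose * U = 1 ∧ U * U.transpose = 1 ∧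
      X.toMatrix = U * Matrix.diagonal X.isHermitian.eigenvalues * U.transpose := by
  have h := X.isHermitian.spectral_theorem
  have h1 := Unitary.coe_star_mul_self X.isHermitian.eigenvectorUnitary
  have h2 := Unitary.coe_mul_star_self X.isHermitian.eigenvectorUnitary
  refine ⟨X.isHermitian.eigenvectorUnitary, ?_, ?_, ?_⟩
  · simpa [Matrix.star_eq_conjTranspose] using h1
  · simpa [Matrix.star_eq_conjTranspose] using h2
  · simpa [Unitary.conjStarAlgAut_apply, Matrix.star_eq_conjTranspose, Function.comp_def] using h

theorem posSemidef_conj_diagonal (U : Matrix (Fin n) (Fin n) ℝ) {d : Fin n → ℝ} (hd : 0 ≤ d) :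
    (U * Matrix.diagonal d * U.transpose).PosSemidef := by
  simpa using (Matrix.PosSemidef.diagonal hd).mul_mul_conjTranspose_same U

theorem exists_eq_transpose_mul_self {X : SymMat n} (hX : X ∈ psdCone n) :
    ∃ Y : Matrix (Fin n) (Fin n) ℝ, X.toMatrix = Y.transpose * Y := by
  obtain ⟨U, -, -, h⟩ := X.exists_spectral
  have h0 := fun i => Matrix.PosSemidef.eigenvalues_nonneg (A := X.toMatrix) hX i
  refine ⟨Matrix.diagonal (fun i => √(X.isHermitian.eigenvalues i)) * U.transpose, ?_⟩
  rw [Matrix.transpose_mul, Matrix.diagonal_transpose, Matrix.transpose_transpose,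
    Matrix.mul_assoc, ← Matrix.mul_assoc (Matrix.diagonal _), Matrix.diagonal_mul_diagonal]
  simp only [Real.mul_self_sqrt (h0 _)]
  rw [← Matrix.mul_assoc]
  exact h

theorem add_mem_psdCone {X Y : SymMat n} (hX : X ∈ psdCone n) (hY : Y ∈ psdCone n) :
    X + Y ∈ psdCone n := by
  simpa [psdCone] using Matrix.PosSemidef.add hX hY

theorem smul_mem_psdCone {X : SymMat n} (hX : X ∈ psdCone n) {c : ℝ} (hc : 0 ≤ c) :
    c • X ∈ psdCone n := by
  simpa [psdCone] using Matrix.PosSemidef.smul hX hc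

theorem inner_nonneg_of_mem_psdCone {X Y : SymMat n} (hX : X ∈ psdCone n) (hY : Y ∈ psdCone n) :
    0 ≤ inner ℝ X Y := by
  obtain ⟨W, hW⟩ := exists_eq_transpose_mul_self hY
  rw [inner_eq_trace_mul, hW, ← Matrix.mul_assoc, Matrix.trace_mul_comm, ← Matrix.mul_assoc]
  have := (Matrix.PosSemidef.mul_mul_conjTranspose_same (A := X.toMatrix) hX W).trace_nonneg
  simpa using this

/-- The positive semidefinite cone is self-dual. -/
theorem mem_psdCone_iff_inner_nonneg {X : SymMat n} :
    X ∈ psdCone n ↔ ∀ Y ∈ psdCone n, 0 ≤ inner ℝ X Y := by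
  refine ⟨fun hX Y hY => inner_nonneg_of_mem_psdCone hX hY, fun h => ?_⟩
  refine Matrix.PosSemidef.of_dotProduct_mulVec_nonneg X.isHermitian fun v => ?_
  have hv : (Matrix.vecMulVec v v).PosSemidef := by
    simpa using Matrix.posSemidef_vecMulVec_self_star v
  have hs : (Matrix.vecMulVec v v).IsSymm := by simpa using hv.isHermitian
  have := h (ofMatrix _ hs) hv
  rwa [inner_eq_trace_mul, toMatrix_ofMatrix, Matrix.mul_vecMulVec, Matrix.trace_vecMulVec,
    dotProduct_comm] at this

theorem isClosed_psdCone : IsClosed (psdCone n) := by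
  have h : psdCone n = ⋂ Y ∈ psdCone n, {X : SymMat n | 0 ≤ inner ℝ X Y} := by
    ext X
    rw [mem_psdCone_iff_inner_nonneg]
    simp
  rw [h]
  exact isClosed_biInter fun Y _ => isClosed_le continuous_const (by fun_prop)

/-- Shifting by the negative part of the spectrum makes a symmetric matrix positive
semidefinite. -/
theorem add_smul_one_mem_psdCone (X : SymMat n) {s : ℝ} (hs : lambdaMax (-X) ≤ s) :
    X + s • (1 : SymMat n) ∈ psdCone n := by
  obtain ⟨U, -, h1, h⟩ := (-X).exists_spectral
  set d := (-X).isHermitian.eigenvalues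
  have hle : ∀ i, d i ≤ s := fun i =>
    (le_ciSup (Set.finite_range d).bddAbove i).trans hs
  have hX : (X + s • (1 : SymMat n)).toMatrix
      = U * Matrix.diagonal (fun i => s - d i) * U.transpose := by
    have e : Matrix.diagonal (fun i => s - d i) = s • (1 : Matrix (Fin n) (Fin n) ℝ)
        - Matrix.diagonal d := by
      rw [← Matrix.diagonal_one, ← Matrix.diagonal_smul, Matrix.diagonal_sub]
      simp
    rw [e, Matrix.mul_sub, Matrix.sub_mul, ← h, Matrix.mul_smul, Matrix.mul_one, Matrix.smul_mul,
      h1, map_add, map_smul, map_neg, toMatrix_one, sub_neg_eq_add, add_comm]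
  change (X + s • (1 : SymMat n)).toMatrix.PosSemidef
  rw [hX]
  exact posSemidef_conj_diagonal U fun i => sub_nonneg.2 (hle i)

/-- The face of the positive semidefinite cone exposed by `Z`. -/
def exposedFace (Z : SymMat n) : Set (SymMat n) := {X | X ∈ psdCone n ∧ inner ℝ Z X = 0}

theorem normalCone_polarCone_psdCone {Z : SymMat n} (hZ : Z ∈ psdCone n) :
    normalCone (polarCone (psdCone n)) (-Z) = exposedFace Z := by
  have hpolar : ∀ Y ∈ psdCone n, -Y ∈ polarCone (psdCone n) := fun Y hY W hW => by
    rw [inner_neg_left]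
    exact neg_nonpos.2 (inner_nonneg_of_mem_psdCone hY hW)
  ext X
  constructor
  · rintro ⟨-, h⟩
    -- test the normal vector at `0`, at `-2 Z` and at `-Y` for `Y` in the cone
    have h0 : inner ℝ X Z ≤ 0 := by
      simpa using h 0 (fun W _ => by simp)
    have h2 : 0 ≤ inner ℝ X Z := by
      have := h (-((2 : ℝ) • Z)) (hpolar _ (smul_mem_psdCone hZ zero_le_two))
      rw [sub_neg_eq_add, inner_add_right, inner_neg_right, inner_smul_right] at this
      linarith
    have h3 : inner ℝ X Z = 0 := le_antisymm h0 h2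
    refine ⟨mem_psdCone_iff_inner_nonneg.2 fun Y hY => ?_, by rw [real_inner_comm, h3]⟩
    have := h (-Y) (hpolar Y hY)
    rw [sub_neg_eq_add, inner_add_right, inner_neg_right, h3] at this
    linarith
  · rintro ⟨hX, h⟩
    refine ⟨hpolar Z hZ, fun Y hY => ?_⟩
    rw [sub_neg_eq_add, inner_add_right, real_inner_comm Z X, h, add_zero, real_inner_comm]
    exact hY X hX

/-- The orthogonal projection `P` onto the kernel of `Z` and its complement `Q`, which is dominated
by a multiple of `Z`. -/
theorem exists_kernel_projection {Z : SymMat n} (hZ : Z ∈ psdCone n) :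
    ∃ P Q : SymMat n, ∃ c : ℝ, 0 < c ∧ P.toMatrix + Q.toMatrix = 1 ∧
      Q.toMatrix * Q.toMatrix = Q.toMatrix ∧ Z.toMatrix * P.toMatrix = 0 ∧
      c • Z - Q ∈ psdCone n := by
  obtain ⟨U, hU1, hU2, hU⟩ := Z.exists_spectral
  have hd0 := fun i => Matrix.PosSemidef.eigenvalues_nonneg (A := Z.toMatrix) hZ i
  set d := Z.isHermitian.eigenvalues
  have hmul : ∀ u v : Fin n → ℝ,
      U * Matrix.diagonal u * U.transpose * (U * Matrix.diagonal v * U.transpose)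
        = U * Matrix.diagonal (fun i => u i * v i) * U.transpose := fun u v => by
    rw [← Matrix.diagonal_mul_diagonal]
    calc _ = U * Matrix.diagonal u * (U.transpose * U) * Matrix.diagonal v * U.transpose := by
          simp only [Matrix.mul_assoc]
      _ = _ := by rw [hU1, Matrix.mul_one, Matrix.mul_assoc U]
  have hsymm : ∀ u : Fin n → ℝ, (U * Matrix.diagonal u * U.transpose).IsSymm := fun u => by
    simp [Matrix.IsSymm, Matrix.transpose_mul, Matrix.mul_assoc]
  let e : Fin n → ℝ := fun i => if d i = 0 then 1 else 0
  -- one constant above the inverses of all the positive eigenvalues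
  obtain ⟨c, hc, hcd⟩ : ∃ c : ℝ, 0 < c ∧ ∀ i, 1 - e i ≤ c * d i := by
    have hs : ∀ i ∈ Finset.univ, 0 ≤ (d i)⁻¹ := fun i _ => inv_nonneg.2 (hd0 i)
    refine ⟨1 + ∑ i, (d i)⁻¹, add_pos_of_pos_of_nonneg one_pos (Finset.sum_nonneg hs),
      fun i => ?_⟩
    by_cases h : d i = 0
    · simp [e, h]
    · have h1 := Finset.single_le_sum hs (Finset.mem_univ i)
      have h2 : (d i)⁻¹ * d i = 1 := inv_mul_cancel₀ h
      have h3 := hd0 i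
      simp only [e, h, if_false]
      nlinarith [mul_le_mul_of_nonneg_right h1 h3]
  refine ⟨ofMatrix _ (hsymm e), ofMatrix _ (hsymm fun i => 1 - e i), c, hc, ?_, ?_, ?_, ?_⟩
  · simp only [toMatrix_ofMatrix]
    rw [← Matrix.add_mul, ← Matrix.mul_add, Matrix.diagonal_add]
    simp [hU2]
  · simp only [toMatrix_ofMatrix]
    rw [hmul]
    congr 3
    ext i
    by_cases h : d i = 0 <;> simp [e, h]
  · have h0 : (fun i => d i * e i) = 0 := by
      ext i
      by_cases h : d i = 0 <;> simp [e, h]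
    rw [toMatrix_ofMatrix, hU, hmul, h0]
    simp
  · have h1 : (c • Z - ofMatrix _ (hsymm fun i => 1 - e i)).toMatrix
        = U * Matrix.diagonal (fun i => c * d i - (1 - e i)) * U.transpose := by
      have e2 : Matrix.diagonal (fun i => c * d i - (1 - e i))
          = c • Matrix.diagonal d - Matrix.diagonal (fun i => 1 - e i) := by
        rw [← Matrix.diagonal_smul, Matrix.diagonal_sub]
        rfl
      rw [e2, Matrix.mul_sub, Matrix.sub_mul, Matrix.mul_smul, Matrix.smul_mul, ← hU, map_sub,
        map_smul, toMatrix_ofMatrix]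
    change Matrix.PosSemidef (toMatrix _)
    rw [h1]
    exact posSemidef_conj_diagonal U fun i => sub_nonneg.2 (hcd i)

open scoped Matrix.Norms.Frobenius in
/-- The distance to the exposed face of `Z` grows at most like the square root of `⟨Z, ·⟩` on
bounded parts of the cone: with `P` the orthogonal projection onto the kernel of `Z` and
`Q = 1 - P`, the point `P X P` of the face differs from `X` by `Q X + P X Q`, whereas
`‖X Q‖² ≤ tr X · tr (X Q)` and `Z` dominates a positive multiple of `Q`. -/
theorem exists_mem_exposedFace_sq_norm_sub_le {Z : SymMat n} (hZ : Z ∈ psdCone n) :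
    ∃ c : ℝ, 0 < c ∧ ∀ X ∈ psdCone n, ∃ W ∈ exposedFace Z,
      ‖X - W‖ ^ 2 ≤ c * ‖X‖ * inner ℝ Z X := by
  obtain ⟨P', Q', c, hc, hPQ, hQQ, hZP, hcQ⟩ := exists_kernel_projection hZ
  have hP : P'.toMatrix.transpose = P'.toMatrix := P'.isSymm
  have hQ : Q'.toMatrix.transpose = Q'.toMatrix := Q'.isSymm
  have hQZ : ∀ X ∈ psdCone n, (X.toMatrix * Q'.toMatrix).trace ≤ c * inner ℝ Z X :=
    fun X hX => by
      have h2 := inner_nonneg_of_mem_psdCone hcQ hX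
      rw [inner_sub_left, inner_smul_left, real_inner_comm X Q', inner_eq_trace_mul X] at h2
      simpa using h2
  generalize P'.toMatrix = P at *
  generalize Q'.toMatrix = Q at *
  refine ⟨(1 + ‖P‖) ^ 2 * (‖(1 : SymMat n)‖ + 1) * c, by positivity, fun X hX => ?_⟩
  have hXt : X.toMatrix.transpose = X.toMatrix := X.isSymm
  have hWpsd : (P * X.toMatrix * P).PosSemidef := by
    have := Matrix.PosSemidef.mul_mul_conjTranspose_same (A := X.toMatrix) hX P
    rwa [Matrix.conjTranspose_eq_transpose_of_trivial, hP] at this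
  have hWs : (P * X.toMatrix * P).IsSymm := by
    simpa using hWpsd.isHermitian
  refine ⟨ofMatrix _ hWs, ⟨hWpsd, ?_⟩, ?_⟩
  · rw [inner_eq_trace_mul, toMatrix_ofMatrix, ← Matrix.mul_assoc, ← Matrix.mul_assoc, hZP]
    simp
  obtain ⟨Y, hY⟩ := exists_eq_transpose_mul_self hX
  have hsub : (X - ofMatrix _ hWs).toMatrix = Q * X.toMatrix + P * (X.toMatrix * Q) := by
    rw [map_sub, toMatrix_ofMatrix]
    have h1 : X.toMatrix = (P + Q) * X.toMatrix * (P + Q) := by rw [hPQ]; simp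
    have h2 : Q * X.toMatrix = Q * X.toMatrix * (P + Q) := by rw [hPQ]; simp
    rw [h2]
    nth_rw 1 [h1]
    noncomm_ring
  have hflip : ‖Q * X.toMatrix‖ = ‖X.toMatrix * Q‖ := by
    rw [← Matrix.frobenius_norm_transpose, Matrix.transpose_mul, hXt, hQ]
  have hn : ‖X - ofMatrix _ hWs‖ ≤ (1 + ‖P‖) * ‖X.toMatrix * Q‖ := by
    rw [← norm_toMatrix, hsub]
    calc _ ≤ ‖Q * X.toMatrix‖ + ‖P * (X.toMatrix * Q)‖ := norm_add_le _ _
      _ ≤ ‖X.toMatrix * Q‖ + ‖P‖ * ‖X.toMatrix * Q‖ := by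
          rw [hflip]
          gcongr
          exact Matrix.frobenius_norm_mul _ _
      _ = _ := by ring
  have hY1 : ‖Y‖ ^ 2 ≤ (‖(1 : SymMat n)‖ + 1) * ‖X‖ := by
    rw [frobenius_norm_sq, ← hY, ← inner_one_right]
    have := real_inner_le_norm X 1
    nlinarith [norm_nonneg X]
  have hYQ : ‖Y * Q‖ ^ 2 ≤ c * inner ℝ Z X := by
    rw [frobenius_norm_sq, Matrix.transpose_mul, hQ]
    refine le_trans (le_of_eq ?_) (hQZ X hX)
    rw [Matrix.mul_assoc, ← Matrix.mul_assoc Y.transpose, ← hY, Matrix.trace_mul_comm,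
      Matrix.mul_assoc, hQQ]
  have hXQ : ‖X.toMatrix * Q‖ ≤ ‖Y‖ * ‖Y * Q‖ := by
    rw [hY, Matrix.mul_assoc, ← Matrix.frobenius_norm_transpose Y]
    exact Matrix.frobenius_norm_mul _ _
  calc ‖X - ofMatrix _ hWs‖ ^ 2 ≤ ((1 + ‖P‖) * (‖Y‖ * ‖Y * Q‖)) ^ 2 := by
        gcongr
        exact hn.trans (by gcongr)
    _ = (1 + ‖P‖) ^ 2 * (‖Y‖ ^ 2 * ‖Y * Q‖ ^ 2) := by ring
    _ ≤ (1 + ‖P‖) ^ 2 * ((‖(1 : SymMat n)‖ + 1) * ‖X‖ * (c * inner ℝ Z X)) := by gcongr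
    _ = _ := by ring

end SymMat

/-! ### Bounded linear regularity -/

/-- A convex set `K` and an affine subspace `{L w = L x₀}` through a relative interior point `x₀` of
`K` are boundedly linearly regular: a point `x` of `K` is first corrected to `x + D` on the affine
subspace by a direction `D` parallel to `K`, and then drawn towards `x₀` just far enough to return
to `K`. -/
theorem exists_mem_eq_norm_sub_le_of_mem_intrinsicInterior
    {E F : Type*} [NormedAddCommGroup E] [NormedSpace ℝ E] [FiniteDimensional ℝ E]
    [NormedAddCommGroup F] [NormedSpace ℝ F] (L : E →L[ℝ] F) {K : Set E} (hK : Convex ℝ K)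
    {x₀ : E} (hx₀ : x₀ ∈ intrinsicInterior ℝ K) :
    ∃ c : ℝ, 0 < c ∧ ∀ x ∈ K, ∃ w ∈ K, L w = L x₀ ∧
      ‖x - w‖ ≤ c * (1 + ‖x - x₀‖) * ‖L x - L x₀‖ := by
  have hx₀K : x₀ ∈ K := intrinsicInterior_subset hx₀
  obtain ⟨r, hr, hball⟩ : ∃ r : ℝ, 0 < r ∧ ∀ D ∈ vectorSpan ℝ K, ‖D‖ ≤ r → x₀ + D ∈ K := by
    obtain ⟨⟨y, hy⟩, hyi, rfl⟩ := mem_intrinsicInterior.1 hx₀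
    obtain ⟨r, hr, h⟩ := Metric.isOpen_iff.1 isOpen_interior _ hyi
    refine ⟨r / 2, half_pos hr, fun D hD hDr => ?_⟩
    have hmem : y + D ∈ affineSpan ℝ K := by
      rw [add_comm]
      exact AffineSubspace.vadd_mem_of_mem_direction (by rwa [direction_affineSpan]) hy
    have : (⟨y + D, hmem⟩ : affineSpan ℝ K) ∈ Metric.ball (⟨y, hy⟩ : affineSpan ℝ K) r := by
      rw [Metric.mem_ball, Subtype.dist_eq, dist_eq_norm]
      simpa using hDr.trans_lt (half_lt_self hr)
    exact interior_subset (s := ((↑) : affineSpan ℝ K → E) ⁻¹' K) (h this)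
  -- on directions parallel to `K`, `L` has bounded preimages: compose with a right inverse
  -- of its corestriction to the image
  obtain ⟨c, hc, hinv⟩ : ∃ c : ℝ, 0 < c ∧ ∀ v ∈ vectorSpan ℝ K, ∃ D ∈ vectorSpan ℝ K,
      L D = L v ∧ ‖D‖ ≤ c * ‖L v‖ := by
    let T := ((L : E →ₗ[ℝ] F).domRestrict (vectorSpan ℝ K)).rangeRestrict
    obtain ⟨G, hG⟩ := T.exists_rightInverse_of_surjective (LinearMap.range_rangeRestrict _)
    refine ⟨‖G.toContinuousLinearMap‖ + 1, by positivity, fun v hv => ?_⟩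
    have h1 : T (G (T ⟨v, hv⟩)) = T ⟨v, hv⟩ := LinearMap.congr_fun hG _
    refine ⟨G (T ⟨v, hv⟩), (G (T ⟨v, hv⟩)).2, congrArg Subtype.val h1, ?_⟩
    have h2 := G.toContinuousLinearMap.le_opNorm (T ⟨v, hv⟩)
    have h3 : ‖T ⟨v, hv⟩‖ = ‖L v‖ := rfl
    rw [h3] at h2
    change ‖G (T ⟨v, hv⟩)‖ ≤ _
    exact h2.trans (by nlinarith [norm_nonneg (L v)])
  refine ⟨c * (1 + 1 / r), by positivity, fun x hx => ?_⟩
  obtain ⟨D, hD, hLD, hDn⟩ := hinv (x₀ - x) (vsub_mem_vectorSpan ℝ hx₀K hx)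
  rw [map_sub, norm_sub_rev] at hDn
  have hpos : 0 < ‖D‖ + r := by positivity
  set t := ‖D‖ / (‖D‖ + r) with ht
  have ht0 : 0 ≤ t := by positivity
  have ht1 : t ≤ 1 := (div_le_one hpos).2 (by linarith)
  have htr : t ≤ ‖D‖ / r := by
    rw [ht]
    gcongr
    linarith [norm_nonneg D]
  -- for `D = 0` the quotient `r / ‖D‖` is `0`, and both sides vanish
  have htD : t • ((r / ‖D‖) • D) = (1 - t) • D := by
    rcases eq_or_ne D 0 with rfl | h
    · simp
    · have : ‖D‖ ≠ 0 := norm_ne_zero_iff.2 h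
      rw [smul_smul]
      congr 1
      rw [ht]
      field_simp
      ring
  have hmem : x₀ + (r / ‖D‖) • D ∈ K := by
    refine hball _ (Submodule.smul_mem _ _ hD) ?_
    rw [norm_smul, norm_div, norm_norm, Real.norm_of_nonneg hr.le]
    rcases eq_or_ne ‖D‖ 0 with h | h
    · simpa [h] using hr.le
    · exact (div_mul_cancel₀ r h).le
  refine ⟨(1 - t) • x + t • (x₀ + (r / ‖D‖) • D), hK hx hmem (sub_nonneg.2 ht1) ht0 (by ring),
    ?_, ?_⟩
  · rw [smul_add, htD, map_add, map_add, map_smul, map_smul, map_smul, hLD, map_sub]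
    module
  · have e : x - ((1 - t) • x + t • (x₀ + (r / ‖D‖) • D)) = t • (x - x₀) - (1 - t) • D := by
      rw [smul_add, htD]
      module
    have h1 : ‖t • (x - x₀)‖ ≤ ‖D‖ / r * ‖x - x₀‖ := by
      rw [norm_smul, Real.norm_of_nonneg ht0]
      gcongr
    have h2 : ‖(1 - t) • D‖ ≤ ‖D‖ := by
      rw [norm_smul, Real.norm_of_nonneg (sub_nonneg.2 ht1)]
      exact mul_le_of_le_one_left (norm_nonneg _) (by linarith)
    rw [e]
    calc _ ≤ ‖D‖ / r * ‖x - x₀‖ + ‖D‖ := (norm_sub_le _ _).trans (add_le_add h1 h2)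
      _ ≤ ‖D‖ * ((1 + 1 / r) * (1 + ‖x - x₀‖)) := by
          have : 0 ≤ ‖D‖ * (1 / r + ‖x - x₀‖) := by positivity
          have e3 : ‖D‖ * ((1 + 1 / r) * (1 + ‖x - x₀‖))
            = ‖D‖ / r * ‖x - x₀‖ + ‖D‖ + ‖D‖ * (1 / r + ‖x - x₀‖) := by ring
          linarith
      _ ≤ c * ‖L x - L x₀‖ * ((1 + 1 / r) * (1 + ‖x - x₀‖)) := by gcongr
      _ = _ := by ring

/-! ### Quadratic growth on the slices of an exposed face -/

namespace SymMat

variable {n : ℕ}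

theorem convex_exposedFace (Z : SymMat n) : Convex ℝ (exposedFace Z) := by
  rintro X ⟨hX, hX0⟩ Y ⟨hY, hY0⟩ a b ha hb -
  refine ⟨add_mem_psdCone (smul_mem_psdCone hX ha) (smul_mem_psdCone hY hb), ?_⟩
  rw [inner_add_right, inner_smul_right, inner_smul_right, hX0, hY0]
  simp

variable {F : Type*} [NormedAddCommGroup F] [NormedSpace ℝ F]

/-- Quadratic growth on bounded sets in a form common to all the penalties: infeasibility of `X` is
measured by its distance to an arbitrary comparison point `Y` of the cone. -/
theorem exists_mul_sq_infDist_le (L : SymMat n →L[ℝ] F) {Z : SymMat n} (hZ : Z ∈ psdCone n)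
    {X₀ : SymMat n} (hX₀ : X₀ ∈ intrinsicInterior ℝ (exposedFace Z)) (M : ℝ) :
    ∃ κ : ℝ, 0 < κ ∧ ∀ X Y : SymMat n, ‖X‖ ≤ M → Y ∈ psdCone n →
      κ * Metric.infDist X {W | L W = L X₀ ∧ W ∈ exposedFace Z} ^ 2
        ≤ inner ℝ Z Y + ‖X - Y‖ + ‖L X - L X₀‖ := by
  obtain ⟨c₁, hc₁, hface⟩ := exists_mem_exposedFace_sq_norm_sub_le hZ
  obtain ⟨c₂, hc₂, hreg⟩ :=
    exists_mem_eq_norm_sub_le_of_mem_intrinsicInterior L (convex_exposedFace Z) hX₀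
  set Ω := {W | L W = L X₀ ∧ W ∈ exposedFace Z}
  have hX₀Ω : X₀ ∈ Ω := ⟨rfl, intrinsicInterior_subset hX₀⟩
  let B := c₁ * (|M| + 1)
  have hB : 0 < B := by positivity
  let T := (|M| + 1) + (B + 1) + ‖X₀‖
  let G := 1 + c₂ * (1 + T) * (‖L‖ + 1)
  let H := 3 * G ^ 2 * (B + 2) + (|M| + ‖X₀‖) ^ 2
  have hH : 0 < H := by positivity
  refine ⟨H⁻¹, inv_pos.2 hH, fun X Y hX hY => ?_⟩
  rw [inv_mul_le_iff₀ hH]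
  set v := inner ℝ Z Y
  set δ := ‖X - Y‖
  set η := ‖L X - L X₀‖
  have hv0 : 0 ≤ v := inner_nonneg_of_mem_psdCone hZ hY
  have hδ0 : 0 ≤ δ := norm_nonneg _
  have hη0 : 0 ≤ η := norm_nonneg _
  have hXM : ‖X‖ ≤ |M| := hX.trans (le_abs_self M)
  have hdist0 : 0 ≤ Metric.infDist X Ω := Metric.infDist_nonneg
  -- if the right-hand side exceeds `1`, boundedness of `X` suffices
  rcases lt_or_ge 1 (v + δ + η) with h | h
  · have h1 : Metric.infDist X Ω ≤ |M| + ‖X₀‖ := by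
      refine (Metric.infDist_le_dist_of_mem hX₀Ω).trans ?_
      rw [dist_eq_norm]
      exact (norm_sub_le _ _).trans (by gcongr)
    calc Metric.infDist X Ω ^ 2 ≤ (|M| + ‖X₀‖) ^ 2 := by gcongr
      _ ≤ H := le_add_of_nonneg_left (by positivity)
      _ ≤ H * (v + δ + η) := le_mul_of_one_le_right hH.le h.le
  · have hYM : ‖Y‖ ≤ |M| + 1 := by
      have : ‖Y‖ ≤ ‖X‖ + ‖X - Y‖ := norm_le_norm_add_norm_sub _ _
      linarith
    obtain ⟨W, hW, hYW⟩ := hface Y hY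
    set q := ‖Y - W‖
    have hq0 : 0 ≤ q := norm_nonneg _
    have hq2 : q ^ 2 ≤ B * v := by
      refine hYW.trans (mul_le_mul_of_nonneg_right ?_ hv0)
      exact mul_le_mul_of_nonneg_left hYM hc₁.le
    have hqB : q ≤ B + 1 := by
      have h1 : B * v ≤ B := mul_le_of_le_one_right hB.le (by linarith)
      refine (sq_le_sq₀ hq0 (by positivity)).1 ?_
      linarith [sq_nonneg B, (by ring : (B + 1) ^ 2 = B ^ 2 + 2 * B + 1)]
    have hWX₀ : ‖W - X₀‖ ≤ T := by
      have h1 := norm_sub_le W X₀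
      have h2 : ‖W‖ ≤ ‖Y‖ + ‖Y - W‖ := norm_le_norm_add_norm_sub _ _
      simp only [T]
      linarith
    obtain ⟨W', hW', hLW', hWW'⟩ := hreg W hW
    have hLW : ‖L W - L X₀‖ ≤ ‖L‖ * (q + δ) + η := by
      have e : L W - L X₀ = L (W - X) + (L X - L X₀) := by rw [map_sub]; abel
      have h1 : ‖W - X‖ ≤ q + δ := by
        have e2 : W - X = -(Y - W) - (X - Y) := by abel
        rw [e2]
        refine (norm_sub_le _ _).trans ?_
        rw [norm_neg]
      rw [e]
      refine (norm_add_le _ _).trans (add_le_add ((L.le_opNorm _).trans ?_) le_rfl)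
      gcongr
    have hXW' : Metric.infDist X Ω ≤ G * (q + δ + η) := by
      refine (Metric.infDist_le_dist_of_mem (s := Ω) (y := W') ⟨hLW', hW'⟩).trans ?_
      have e : X - W' = (X - Y) + (Y - W) + (W - W') := by abel
      rw [dist_eq_norm, e]
      calc _ ≤ δ + q + ‖W - W'‖ := norm_add₃_le
        _ ≤ δ + q + c₂ * (1 + T) * (‖L‖ * (q + δ) + η) := by
            have : ‖W - W'‖ ≤ c₂ * (1 + T) * (‖L‖ * (q + δ) + η) :=
              hWW'.trans (by gcongr)
            linarith
        _ ≤ δ + q + η + c₂ * (1 + T) * ((‖L‖ + 1) * (q + δ + η)) := by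
            have h1 : ‖L‖ * (q + δ) + η ≤ (‖L‖ + 1) * (q + δ + η) := by
              linarith [mul_nonneg (norm_nonneg L) hη0,
                (by ring : (‖L‖ + 1) * (q + δ + η) = ‖L‖ * (q + δ) + η + (q + δ) + ‖L‖ * η)]
            have : c₂ * (1 + T) * (‖L‖ * (q + δ) + η)
                ≤ c₂ * (1 + T) * ((‖L‖ + 1) * (q + δ + η)) := by gcongr
            linarith
        _ = _ := by ring
    have hsq : (q + δ + η) ^ 2 ≤ 3 * ((B + 2) * (v + δ + η)) := by
      have h1 : δ ^ 2 ≤ δ := pow_le_of_le_one hδ0 (by linarith) two_ne_zero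
      have h2 : η ^ 2 ≤ η := pow_le_of_le_one hη0 (by linarith) two_ne_zero
      have h3 : B * v ≤ B * (v + δ + η) := by gcongr; linarith
      have h4 : (q + δ + η) ^ 2 ≤ 3 * (q ^ 2 + δ ^ 2 + η ^ 2) := by
        linarith [sq_nonneg (q - δ), sq_nonneg (q - η), sq_nonneg (δ - η),
          (by ring : (q + δ + η) ^ 2 + (q - δ) ^ 2 + (q - η) ^ 2 + (δ - η) ^ 2
            = 3 * (q ^ 2 + δ ^ 2 + η ^ 2))]
      rw [add_mul]
      linarith
    calc Metric.infDist X Ω ^ 2 ≤ (G * (q + δ + η)) ^ 2 := by gcongr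
      _ = G ^ 2 * (q + δ + η) ^ 2 := by ring
      _ ≤ G ^ 2 * (3 * ((B + 2) * (v + δ + η))) := by gcongr
      _ = 3 * G ^ 2 * (B + 2) * (v + δ + η) := by ring
      _ ≤ H * (v + δ + η) := by
          gcongr
          exact le_add_of_nonneg_right (by positivity)

/-- If the solution set is bounded, quadratic growth just outside of a ball containing it extends
along the rays from `X₀` to linear growth at infinity, so that sublevel sets are bounded. -/
theorem exists_norm_le_of_isBounded (L : SymMat n →L[ℝ] F) {Z : SymMat n} (hZ : Z ∈ psdCone n)
    {X₀ : SymMat n} (hX₀ : X₀ ∈ intrinsicInterior ℝ (exposedFace Z))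
    (hb : Bornology.IsBounded {W | L W = L X₀ ∧ W ∈ exposedFace Z}) (β : ℝ) :
    ∃ R : ℝ, ∀ X Y : SymMat n, Y ∈ psdCone n → L X = L X₀ → inner ℝ Z Y + ‖X - Y‖ ≤ β →
      ‖X‖ ≤ R := by
  obtain ⟨r, hr, hΩ⟩ := hb.subset_ball_lt 0 X₀
  obtain ⟨κ, hκ, hgrow⟩ := exists_mul_sq_infDist_le L hZ hX₀ (‖X₀‖ + (r + 1))
  have hX₀f : X₀ ∈ exposedFace Z := intrinsicInterior_subset hX₀
  refine ⟨‖X₀‖ + (r + 1) * (1 + |β| / κ), fun X Y hY hLX hβ => ?_⟩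
  suffices h : ‖X - X₀‖ ≤ (r + 1) * (1 + |β| / κ) by
    have : ‖X‖ ≤ ‖X₀‖ + ‖X₀ - X‖ := norm_le_norm_add_norm_sub _ _
    rw [norm_sub_rev] at this
    linarith
  have hβκ : 0 ≤ |β| / κ := by positivity
  rcases le_or_gt ‖X - X₀‖ (r + 1) with h | h
  · nlinarith
  set t := ‖X - X₀‖
  have ht : 0 < t := by linarith
  -- move the pair `(X, Y)` towards `X₀` until `X` is at distance `r + 1` from it; this scales the
  -- right-hand side of the growth estimate by `θ`
  set θ := (r + 1) / t with hθ
  have hθ0 : 0 < θ := by positivity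
  have hθ1 : θ ≤ 1 := (div_le_one ht).2 h.le
  have hθt : θ * t = r + 1 := by rw [hθ]; field_simp
  have hnorm : ‖θ • (X - X₀)‖ = r + 1 := by
    rw [norm_smul, Real.norm_of_nonneg hθ0.le, hθt]
  have h1 := hgrow (X₀ + θ • (X - X₀)) ((1 - θ) • X₀ + θ • Y)
    ((norm_add_le _ _).trans (by rw [hnorm]))
    (add_mem_psdCone (smul_mem_psdCone hX₀f.1 (by linarith)) (smul_mem_psdCone hY hθ0.le))
  have e1 : X₀ + θ • (X - X₀) - ((1 - θ) • X₀ + θ • Y) = θ • (X - Y) := by module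
  have e2 : L (X₀ + θ • (X - X₀)) - L X₀ = 0 := by
    rw [map_add, map_smul, map_sub, hLX]
    simp
  have hd : 1 ≤ Metric.infDist (X₀ + θ • (X - X₀)) {W | L W = L X₀ ∧ W ∈ exposedFace Z} := by
    have hne : {W | L W = L X₀ ∧ W ∈ exposedFace Z}.Nonempty := ⟨X₀, rfl, hX₀f⟩
    refine (Metric.le_infDist hne).2 fun W hW => ?_
    have h2 := hΩ hW
    rw [Metric.mem_ball] at h2
    have h3 := dist_triangle (X₀ + θ • (X - X₀)) W X₀
    have h4 : dist (X₀ + θ • (X - X₀)) X₀ = r + 1 := by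
      rw [dist_eq_norm, add_sub_cancel_left, hnorm]
    linarith
  rw [e1, e2, norm_zero, inner_add_right, inner_smul_right, inner_smul_right, hX₀f.2, norm_smul,
    Real.norm_of_nonneg hθ0.le] at h1
  have h5 : κ ≤ θ * |β| := by
    have h6 : κ * 1 ≤ κ * Metric.infDist (X₀ + θ • (X - X₀))
        {W | L W = L X₀ ∧ W ∈ exposedFace Z} ^ 2 := by
      gcongr
      exact one_le_pow₀ hd
    have h7 : θ * (inner ℝ Z Y + ‖X - Y‖) ≤ θ * |β| := by
      gcongr
      exact hβ.trans (le_abs_self β)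
    linarith
  have h8 : t * κ ≤ (r + 1) * |β| := by
    rw [← hθt]
    nlinarith
  have h9 : t ≤ (r + 1) * |β| / κ := (le_div_iff₀ hκ).2 h8
  have e3 : (r + 1) * (1 + |β| / κ) = (r + 1) + (r + 1) * |β| / κ := by ring
  linarith

end SymMat

/-! ### Exact penalties -/

namespace SymMat

variable {n : ℕ}

/-- The property of a penalty `g` that makes it exact with respect to a dual slack `Z`: wherever `g`
is finite, `⟨Z, X⟩ + g X` dominates `⟨Z, Y⟩ + a ‖X - Y‖` for some `Y` in the cone. -/
def IsExactPenalty (Z : SymMat n) (g : SymMat n → EReal) : Prop :=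
  ∃ a : ℝ, 0 < a ∧ a ≤ 1 ∧ ∀ X, g X = ⊤ ∨ ∃ s : ℝ, g X = (s : EReal) ∧
    ∃ Y ∈ psdCone n, inner ℝ Z Y + a * ‖X - Y‖ ≤ inner ℝ Z X + s

theorem isExactPenalty_psdIndicator (Z : SymMat n) : IsExactPenalty Z psdIndicator := by
  refine ⟨1, one_pos, le_rfl, fun X => ?_⟩
  by_cases h : X ∈ psdCone n
  · exact Or.inr ⟨0, by simp [psdIndicator, h], X, h, by simp⟩
  · exact Or.inl (by simp [psdIndicator, h])

/-- With `s = max 0 (λ_max (-X))`, the shift `X + s I` lies in the cone and costs `s · tr Z`, which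
the penalty `ρ s` outweighs. -/
theorem isExactPenalty_penalty {Z : SymMat n} {ρ : ℝ} (hρ : Z.toMatrix.trace < ρ) :
    IsExactPenalty Z (penalty ρ) := by
  set τ := ρ - Z.toMatrix.trace with hτ
  have hτ0 : 0 < τ := sub_pos.2 hρ
  set N := ‖(1 : SymMat n)‖
  have hN0 : 0 ≤ N := norm_nonneg _
  refine ⟨min 1 (τ / (N + 1)), by positivity, min_le_left _ _, fun X => Or.inr ?_⟩
  set s := max 0 (lambdaMax (-X)) with hs
  have hs0 : 0 ≤ s := le_max_left _ _
  refine ⟨ρ * s, rfl, X + s • 1, add_smul_one_mem_psdCone X (le_max_right _ _), ?_⟩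
  have e : X - (X + s • (1 : SymMat n)) = -(s • 1) := by abel
  rw [e, norm_neg, norm_smul, Real.norm_of_nonneg hs0, inner_add_right, inner_smul_right,
    inner_one_right]
  have h1 : min 1 (τ / (N + 1)) * (s * N) ≤ τ * s :=
    calc _ ≤ τ / (N + 1) * (s * (N + 1)) := by
          gcongr
          · exact min_le_right _ _
          · linarith
      _ = τ * s := by
          have hN : N + 1 ≠ 0 := by positivity
          field_simp
  have h2 : τ * s = ρ * s - s * Z.toMatrix.trace := by rw [hτ]; ring
  change _ + min 1 (τ / (N + 1)) * (s * N) ≤ _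
  linarith

end SymMat

/-! ### Semidefinite programs -/

namespace SDP

open SymMat

variable {n m : ℕ} (S : SDP n m)

/-- The map `𝒜` as a continuous linear map. -/
def mapL : SymMat n →L[ℝ] EuclideanSpace ℝ (Fin m) :=
  LinearMap.toContinuousLinearMap
    { toFun := S.map
      map_add' := fun X Y => by
        ext i
        simp [map, inner_add_right]
      map_smul' := fun c X => by
        ext i
        simp [map, inner_smul_right] }

@[simp]
theorem mapL_apply (X : SymMat n) : S.mapL X = S.map X := rfl

theorem inner_adj (y : EuclideanSpace ℝ (Fin m)) (X : SymMat n) :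
    inner ℝ (S.adj y) X = inner ℝ y (S.map X) := by
  simp [adj, map, sum_inner, inner_smul_left, PiLp.inner_apply, mul_comm]

variable {S} {Xbar : SymMat n} {ybar : EuclideanSpace ℝ (Fin m)} {Zbar : SymMat n}

namespace DualStrictComplementary

theorem mem_psdCone (hsc : S.DualStrictComplementary Xbar ybar Zbar) : Zbar ∈ psdCone n :=
  hsc.2.1.1.2

theorem map_eq (hsc : S.DualStrictComplementary Xbar ybar Zbar) : S.map Xbar = S.b :=
  hsc.1.1.1

theorem inner_C (hsc : S.DualStrictComplementary Xbar ybar Zbar) (X : SymMat n) :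
    inner ℝ S.C X = inner ℝ ybar (S.map X) + inner ℝ Zbar X := by
  have h : S.adj ybar + Zbar = S.C := hsc.2.1.1.1
  rw [← h, inner_add_left, inner_adj]

theorem mem_intrinsicInterior (hsc : S.DualStrictComplementary Xbar ybar Zbar) :
    Xbar ∈ intrinsicInterior ℝ (exposedFace Zbar) := by
  rw [← normalCone_polarCone_psdCone hsc.mem_psdCone]
  exact hsc.2.2

theorem inner_eq_zero (hsc : S.DualStrictComplementary Xbar ybar Zbar) :
    inner ℝ Zbar Xbar = 0 :=
  (intrinsicInterior_subset hsc.mem_intrinsicInterior).2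

theorem primalValue_eq (hsc : S.DualStrictComplementary Xbar ybar Zbar) :
    S.primalValue = ((inner ℝ ybar S.b : ℝ) : EReal) := by
  have h : ((inner ℝ S.C Xbar : ℝ) : EReal) = S.primalValue := hsc.1.2
  rw [← h, hsc.inner_C, hsc.inner_eq_zero, hsc.map_eq, add_zero]

/-- Complementary slackness: the optimal solutions are the feasible points of the face exposed by
the dual slack. -/
theorem primalSolutions_eq (hsc : S.DualStrictComplementary Xbar ybar Zbar) :
    S.primalSolutions = {W | S.mapL W = S.mapL Xbar ∧ W ∈ exposedFace Zbar} := by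
  ext W
  have hb : S.mapL Xbar = S.b := hsc.map_eq
  simp only [primalSolutions, primalFeasible, exposedFace, Set.mem_ofPred_eq, hb, mapL_apply]
  constructor
  · rintro ⟨⟨h1, h2⟩, h3⟩
    refine ⟨h1, h2, ?_⟩
    rw [hsc.primalValue_eq, hsc.inner_C, h1, EReal.coe_eq_coe_iff] at h3
    linarith
  · rintro ⟨h1, h2, h3⟩
    refine ⟨⟨h1, h2⟩, ?_⟩
    rw [hsc.primalValue_eq, hsc.inner_C, h1, h3, add_zero]

/-- The growth bounds hold on bounded sets, for every exact penalty. -/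
theorem exists_growthBounds (hsc : S.DualStrictComplementary Xbar ybar Zbar)
    {g : SymMat n → EReal} (hg : IsExactPenalty Zbar g) {U : Set (SymMat n)}
    (hU : Bornology.IsBounded U) :
    ∃ κ γ α : ℝ, 0 < κ ∧ 0 < γ ∧ 0 < α ∧ S.GrowthBounds g κ γ α U := by
  obtain ⟨M, hM⟩ := hU.exists_norm_le
  obtain ⟨a, ha, ha1, hg⟩ := hg
  obtain ⟨κ, hκ, hgrow⟩ := exists_mul_sq_infDist_le S.mapL hsc.mem_psdCone
    hsc.mem_intrinsicInterior M
  rw [← hsc.primalSolutions_eq] at hgrow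
  have hb : S.mapL Xbar = S.b := hsc.map_eq
  simp only [hb, mapL_apply] at hgrow
  -- the objective gap in terms of the slack and the equality residual
  have hgap : ∀ X, inner ℝ Zbar X + ‖S.map X - S.b‖ ≤
      inner ℝ S.C X - inner ℝ ybar S.b + (‖ybar‖ + 1) * ‖S.map X - S.b‖ := fun X => by
    have h1 := hsc.inner_C X
    have h2 : -(‖ybar‖ * ‖S.map X - S.b‖) ≤ inner ℝ ybar (S.map X - S.b) :=
      neg_le_of_abs_le (abs_real_inner_le_norm _ _)
    rw [inner_sub_right] at h2
    linarith
  refine ⟨a * κ, ‖ybar‖ + 1, ‖Zbar‖ + 1, by positivity, by positivity, by positivity,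
    fun X hX => ?_, fun X hX => ?_⟩
  · rw [hsc.primalValue_eq, cost]
    rcases hg X with h | ⟨s, h, Y, hY, hs⟩
    · rw [h, EReal.coe_add_top, EReal.top_sub_coe, EReal.top_add_coe]
      exact le_top
    · rw [h]
      norm_cast
      have h1 := hgrow X Y (hM X hX) hY
      have h2 := hgap X
      have h3 := inner_nonneg_of_mem_psdCone hsc.mem_psdCone hY
      have h4 := mul_le_mul_of_nonneg_left h1 ha.le
      have h5 : a * inner ℝ Zbar Y ≤ inner ℝ Zbar Y := mul_le_of_le_one_left h3 ha1
      have h6 : a * ‖S.map X - S.b‖ ≤ ‖S.map X - S.b‖ :=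
        mul_le_of_le_one_left (norm_nonneg _) ha1
      linarith
  · rw [hsc.primalValue_eq]
    norm_cast
    -- replacing `X` by its projection `Y` costs at most `‖Z‖ ‖X - Y‖`, whence `α = ‖Z‖ + 1`
    obtain ⟨Y, hY, hXY⟩ := isClosed_psdCone.exists_infDist_eq_dist ⟨Zbar, hsc.mem_psdCone⟩ X
    rw [hXY, dist_eq_norm]
    have h1 := hgrow X Y (hM X hX) hY
    have h2 := hgap X
    have h3 : -(‖Zbar‖ * ‖X - Y‖) ≤ inner ℝ Zbar (X - Y) :=
      neg_le_of_abs_le (abs_real_inner_le_norm _ _)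
    rw [inner_sub_right] at h3
    have h4 : a * (κ * Metric.infDist X S.primalSolutions ^ 2)
        ≤ κ * Metric.infDist X S.primalSolutions ^ 2 :=
      mul_le_of_le_one_left (by positivity) ha1
    linarith

theorem isBounded_sublevel (hsc : S.DualStrictComplementary Xbar ybar Zbar)
    {g : SymMat n → EReal} (hg : IsExactPenalty Zbar g)
    (hΩ : Bornology.IsBounded S.primalSolutions) (β : ℝ) :
    Bornology.IsBounded (S.sublevel g β) := by
  obtain ⟨a, ha, ha1, hg⟩ := hg
  rw [hsc.primalSolutions_eq] at hΩ
  obtain ⟨R, hR⟩ := exists_norm_le_of_isBounded S.mapL hsc.mem_psdCone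
    hsc.mem_intrinsicInterior hΩ ((β - inner ℝ ybar S.b) / a)
  refine isBounded_iff_forall_norm_le.2 ⟨R, ?_⟩
  rintro X ⟨hXβ, hXb⟩
  rw [cost] at hXβ
  rcases hg X with h | ⟨s, h, Y, hY, hs⟩
  · rw [h, EReal.coe_add_top] at hXβ
    exact absurd hXβ (not_le.2 (EReal.coe_lt_top β))
  · rw [h, hsc.inner_C, hXb] at hXβ
    norm_cast at hXβ
    refine hR X Y hY (hXb.trans hsc.map_eq.symm) ((le_div_iff₀ ha).2 ?_)
    have h3 := inner_nonneg_of_mem_psdCone hsc.mem_psdCone hY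
    have h5 : a * inner ℝ Zbar Y ≤ inner ℝ Zbar Y := mul_le_of_le_one_left h3 ha1
    linarith

end DualStrictComplementary

end SDP

theorem mainTheorem2 {n m : ℕ} (S : SDP n m) (hA : Function.Surjective S.map)
    (hdual : S.StrongDuality)
    (Xbar : SymMat n) (ybar : EuclideanSpace ℝ (Fin m)) (Zbar : SymMat n)
    (hsc : S.DualStrictComplementary Xbar ybar Zbar)
    (g : SymMat n → EReal)
    (hg : g = SymMat.psdIndicator ∨
      ∃ ρ : ℝ, Zbar.toMatrix.trace < ρ ∧ g = SymMat.penalty ρ) :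
    (∀ U : Set (SymMat n), IsCompact U → (U ∩ S.primalSolutions).Nonempty →
      ∃ κ γ α : ℝ, 0 < κ ∧ 0 < γ ∧ 0 < α ∧ S.GrowthBounds g κ γ α U) ∧
    (IsCompact S.primalSolutions → ∀ β : ℝ,
      ∃ κ γ α : ℝ, 0 < κ ∧ 0 < γ ∧ 0 < α ∧ S.GrowthBounds g κ γ α (S.sublevel g β)) := by
  have hex : SymMat.IsExactPenalty Zbar g := by
    rcases hg with rfl | ⟨ρ, hρ, rfl⟩
    · exact SymMat.isExactPenalty_psdIndicator Zbar
    · exact SymMat.isExactPenalty_penalty hρ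
  exact ⟨fun U hU _ => hsc.exists_growthBounds hex hU.isBounded,
    fun hΩ β => hsc.exists_growthBounds hex (hsc.isBounded_sublevel hex hΩ.isBounded β)⟩

end
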